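/- Let $d\ge 1$ be an integer, $\alpha\ge 0$, $\beta,L>0$, and let $\mathcal C\subset\mathbb R^d$ be compact. Balls $\mathcal B(x,r)$ are closed Euclidean balls and $\lambda$ is Lebesgue measure. **Definitions.** Let $\lfloor\beta\rfloor$ denote the largest integer strictly less than $\beta$. The class $\Sigma(\beta,L,\mathbb R^d)$ consists of the $\lfloor\beta\rfloor$ times continuously differentiable functions $g:\mathbb R^d\to\mathbb R$ with $|g(x')-g_x(x')|\le L\|x-x'\|^\beta$ for all $x,x'$, where $g_x$ is the Taylor polynomial of $g$ at $x$ of degree $\lfloor\beta\rfloor$. A Lebesgue measurable set $A\subset\mathbb R^d$ is $(c_0,r_0)$-regular if $\lambda[A\cap\mathcal B(x,r)]\ge c_0\lambda[\mathcal B(x,r)]$ for all $x\in A$ and $0<r\le r_0$. For a law $P$ of $(X,Y)$ on $\mathbb R^d\times\{0,1\}$, $P_X$ denotes the law of $X$, and a regression function of $P$ is a measurable $\eta:\mathbb R^d\to[0,1]$ that is a version of $x\mapsto P(Y=1\mid X=x)$. For $c_0,r_0,C_0>0$ and $\mu_{\max}>\mu_{\min}>0$, let $\mathcal P_\Sigma$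 be the class of laws $P$ on $\mathbb R^d\times\{0,1\}$ that have a regression function $\eta\in\Sigma(\beta,L,\mathbb R^d)$, that satisfy $P_X(0<|\eta(X)-1/2|\le t)\le C_0t^\alpha$ for all $t>0$, and for which there are a compact $(c_0,r_0)$-regular set $A\subseteq\mathcal C$ and a density $\mu$ of $P_X$ with respect to $\lambda$ with $\mu_{\min}\le\mu\le\mu_{\max}$ on $A$ and $\mu=0$ off $A$. For $P\in\mathcal P_\Sigma$, continuous regression functions exist, and any two of them coincide on the support of $P_X$. A function $f:\mathbb R^d\to\mathbb R$ *hits* the level $a$ at $x_0$ if $f(x_0)=a$ and every ball $\mathcal B(x_0,r)$, $r>0$, contains an $x$ with $f(x)\ne a$; it *crosses* $a$ at $x_0$ if every ball $\mathcal B(x_0,r)$, $r>0$, contains $x_-,x_+$ with $f(x_-)<a<f(x_+)$. We say that the regression function of $P\in\mathcal P_\Sigma$ hits (crosses) $1/2$ at $x_0$ if every continuous regression function of $P$ does, and that it does not if none does. **Proposition.** (i) If $\alpha(1\wedge\beta)>d$, then for all $c_0,r_0,C_0>0$ and $\mu_{\max}>\mu_{\min}>0$ and every $P\in\mathcal P_\Sigma$,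 the regression function of $P$ does not hit $1/2$ at any point of the interior of the support of $P_X$. (ii) If $d\ge\alpha(1\wedge\beta)$ and $\mathcal C$ has non-empty interior, then for some $c_0,r_0,C_0>0$ and $\mu_{\max}>\mu_{\min}>0$ there is a $P\in\mathcal P_\Sigma$ whose regression function hits $1/2$ at some point of the boundary of the support of $P_X$. (iii) If $d\ge2\alpha$ and $\mathcal C$ has non-empty interior, then for some $c_0,r_0,C_0>0$ and $\mu_{\max}>\mu_{\min}>0$ there is a $P\in\mathcal P_\Sigma$ whose regression function hits $1/2$ at some point of the interior of the support of $P_X$. (iv) If $\alpha(1\wedge\beta)>1$, then for all $c_0,r_0,C_0>0$ and $\mu_{\max}>\mu_{\min}>0$ and every $P\in\mathcal P_\Sigma$, the regression function of $P$ does not cross $1/2$ at any point of the interior of the support of $P_X$. Conversely, if $\alpha(1\wedge\beta)\le1$ and $\mathcal C$ has non-empty interior, then for some $c_0,r_0,C_0>0$ and $\mu_{\max}>\mu_{\min}>0$ there is a $P\in\mathcal P_\Sigma$ whose regression function crosses $1/2$ at some point of the interior of the support of $P_X$. -/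

import Mathlib

noncomputable section

namespace FastPlugin

open MeasureTheory ProbabilityTheory Set

/-- The feature space `ℝ^d` with its Euclidean norm (and Lebesgue measure `volume`). -/
abbrev E (d : ℕ) : Type := EuclideanSpace ℝ (Fin d)

/-- For `β > 0`, the maximal integer that is strictly less than `β`. -/
def holderFloor (β : ℝ) : ℕ := ⌈β⌉₊ - 1

/-- Taylor polynomial of degree `l` of `g` at the point `x`, evaluated at `x'`. The term of order `k`
is the `k`-th differential of `g` at `x` evaluated at `(x' - x, …, x' - x)` and divided by `k!`;
in coordinates it is the sum over multi-indices `s` with `|s| = k` of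
`(x' - x)^s / s! * D^s g (x)`. -/
def taylorPoly {d : ℕ} (l : ℕ) (g : E d → ℝ) (x x' : E d) : ℝ :=
  ∑ k ∈ Finset.range (l + 1),
    ((k.factorial : ℝ))⁻¹ * iteratedFDeriv ℝ k g x (fun _ => x' - x)

/-- The Hölder class `Σ(β, L, ℝ^d)`. -/
def holderClass (d : ℕ) (β L : ℝ) : Set (E d → ℝ) :=
  {g | ContDiff ℝ (holderFloor β : ℕ) g ∧
    ∀ x x' : E d, |g x' - taylorPoly (holderFloor β) g x x'| ≤ L * ‖x - x'‖ ^ β}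

/-- `A` is a (Lebesgue measurable) `(c₀, r₀)`-regular set. -/
def IsRegularSet {d : ℕ} (c₀ r₀ : ℝ) (A : Set (E d)) : Prop :=
  NullMeasurableSet A volume ∧
    ∀ x ∈ A, ∀ r : ℝ, 0 < r → r ≤ r₀ →
      ENNReal.ofReal c₀ * volume (Metric.closedBall x r) ≤ volume (A ∩ Metric.closedBall x r)

/-- The strong density assumption on a measure `Q` on `ℝ^d`. -/
def StrongDensity {d : ℕ} (c₀ r₀ μmin μmax : ℝ) (C : Set (E d)) (Q : Measure (E d)) : Prop :=
  ∃ A : Set (E d), IsCompact A ∧ A ⊆ C ∧ IsRegularSet c₀ r₀ A ∧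
    ∃ μ : E d → ℝ, Measurable μ ∧ Q = volume.withDensity (fun x => ENNReal.ofReal (μ x)) ∧
      (∀ x ∈ A, μmin ≤ μ x ∧ μ x ≤ μmax) ∧ ∀ x ∉ A, μ x = 0

/-- The marginal law `P_X` of a law `P` of `(X, Y)` on `ℝ^d × {0, 1}`. -/
def marginal {d : ℕ} (P : ProbabilityMeasure (E d × Fin 2)) : Measure (E d) :=
  (P : Measure (E d × Fin 2)).fst

/-- `η` is (a version of) the regression function `x ↦ P(Y = 1 | X = x)`, where the conditional law
of `Y` given `X` is a regular conditional probability. -/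
def IsRegressionFunction {d : ℕ} (P : ProbabilityMeasure (E d × Fin 2)) (η : E d → ℝ) : Prop :=
  Measurable η ∧ (∀ x, η x ∈ Icc (0 : ℝ) 1) ∧
    ∀ᵐ x ∂(marginal P), η x = ((P : Measure (E d × Fin 2)).condKernel x).real {1}

/-- The margin assumption for the marginal `Q` and the regression function `η`. -/
def MarginAssumption {d : ℕ} (C₀ α : ℝ) (Q : Measure (E d)) (η : E d → ℝ) : Prop :=
  ∀ t : ℝ, 0 < t →
    Q {x | 0 < |η x - 1 / 2| ∧ |η x - 1 / 2| ≤ t} ≤ ENNReal.ofReal (C₀ * t ^ α)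

/-- The class of laws of `(X, Y)`: margin assumption, Hölder regression function and
strong density assumption. -/
def lawClass {d : ℕ} (α c₀ r₀ C₀ β L μmin μmax : ℝ) (C : Set (E d)) :
    Set (ProbabilityMeasure (E d × Fin 2)) :=
  {P | StrongDensity c₀ r₀ μmin μmax C (marginal P) ∧
    ∃ η : E d → ℝ, IsRegressionFunction P η ∧ η ∈ holderClass d β L ∧
      MarginAssumption C₀ α (marginal P) η}

/-- `f` hits the level `a` at `x₀`. -/
def HitsAt {d : ℕ} (f : E d → ℝ) (a : ℝ) (x₀ : E d) : Prop :=
  f x₀ = a ∧ ∀ r : ℝ, 0 < r → ∃ x ∈ Metric.closedBall x₀ r, f x ≠ a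

/-- `f` crosses the level `a` at `x₀`. -/
def CrossesAt {d : ℕ} (f : E d → ℝ) (a : ℝ) (x₀ : E d) : Prop :=
  ∀ r : ℝ, 0 < r →
    ∃ xm ∈ Metric.closedBall x₀ r, ∃ xp ∈ Metric.closedBall x₀ r, f xm < a ∧ a < f xp

end FastPlugin

end

open FastPlugin

namespace FastPlugin

open MeasureTheory ProbabilityTheory Set Filter Topology

/-! Write `γ = min 1 β`. All continuous regression functions agree on the support of the marginal,
so inside the support each is locally `γ`-Hölder, and there the density bound `μmin` turns the
margin assumption into a bound of order `t ^ α` on the Lebesgue volume of sets where `0 < |η - 1/2|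
≤ t`. The negative claims play these two facts against each other at a small scale.

Hitting (`not_hitsAt_of_local_bounds`): by continuity `|η - 1/2|` equals `2 K s ^ γ` at some point
near `x₀`, and stays comparable to `s ^ γ` on the ball of radius `s` about it. Hence `s ^ d ≲ s ^
(αγ)`, which fails as `s → 0` if `d < αγ`. Crossing (`not_crossesAt_of_local_bounds`): a tube of
parallel segments joins a ball where `η < 1/2` to one where `η > 1/2`; each segment has a stretch of
relative length `δ` on which `0 < η - 1/2 ≲ δ ^ γ`, and Fubini gives `δ ≲ δ ^ (αγ)`, which fails if
`1 < αγ`.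

The examples put the uniform law on a convex body and prescribe the regression function
(`exists_mem_lawClass_of_convex`). Where the level is approached like `|x i - x₀ i| ^ γ`, the margin
set lies in a slab of width `t ^ (1/γ)`: this gives the crossing. If the body is a cone meeting the
level set only at its vertex, the slab becomes a ball of volume `t ^ (d/γ)`: boundary hitting. A
quadratic minimum gives a ball of volume `t ^ (d/2)`: interior hitting. -/

lemma eventually_mul_rpow_lt_mul_rpow {c C p q : ℝ} (hc : 0 < c) (hpq : p < q) :
    ∀ᶠ s : ℝ in 𝓝[>] 0, C * s ^ q < c * s ^ p := by
  have h : Tendsto (fun s : ℝ => C * s ^ (q - p)) (𝓝[>] 0) (𝓝 (C * 0 ^ (q - p))) :=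
    (((Real.continuousAt_rpow_const 0 (q - p) (Or.inr (by linarith))).tendsto).mono_left
      nhdsWithin_le_nhds).const_mul C
  rw [Real.zero_rpow (by linarith), mul_zero] at h
  filter_upwards [h.eventually_lt_const hc, self_mem_nhdsWithin] with s hs hs0
  have hs0 : 0 < s := hs0
  have : s ^ q = s ^ (q - p) * s ^ p := by rw [← Real.rpow_add hs0]; ring_nf
  rw [this, ← mul_assoc]
  exact mul_lt_mul_of_pos_right hs (Real.rpow_pos_of_pos hs0 p)

lemma eventually_mul_rpow_lt {c C q : ℝ} (hc : 0 < c) (hq : 0 < q) :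
    ∀ᶠ s : ℝ in 𝓝[>] 0, C * s ^ q < c := by
  simpa using eventually_mul_rpow_lt_mul_rpow (C := C) hc hq

/-! ### Local Hölder and margin bounds inside the support -/

/-- Continuous functions that agree almost everywhere agree on the support. -/
lemma eqOn_support_of_ae_eq {X Y : Type*} [TopologicalSpace X] [MeasurableSpace X]
    [TopologicalSpace Y] [T2Space Y] {Q : Measure X} {f g : X → Y}
    (hf : Continuous f) (hg : Continuous g) (h : f =ᵐ[Q] g) : EqOn f g Q.support := by
  intro x hx
  exact (Measure.support_subset_of_isClosed (isClosed_eq hf hg) h) hx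

lemma IsRegressionFunction.eqOn_support {d : ℕ} {P : ProbabilityMeasure (E d × Fin 2)}
    {f g : E d → ℝ} (hf : IsRegressionFunction P f) (hg : IsRegressionFunction P g)
    (hfc : Continuous f) (hgc : Continuous g) : EqOn f g (marginal P).support := by
  refine eqOn_support_of_ae_eq hfc hgc ?_
  filter_upwards [hf.2.2, hg.2.2] with x h1 h2
  rw [h1, h2]

lemma continuous_of_mem_holderClass {d : ℕ} {β L : ℝ} {g : E d → ℝ}
    (hg : g ∈ holderClass d β L) : Continuous g := hg.1.continuous

lemma holderFloor_eq_zero {β : ℝ} (hβ1 : β ≤ 1) : holderFloor β = 0 := by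
  have : ⌈β⌉₊ ≤ 1 := Nat.ceil_le.2 (by simpa using hβ1)
  unfold holderFloor; omega

lemma taylorPoly_zero {d : ℕ} (g : E d → ℝ) (x x' : E d) : taylorPoly 0 g x x' = g x := by
  simp [taylorPoly]

/-- For `β ≤ 1` the Taylor polynomial is constant and the class condition is the Hölder bound. For
`β > 1` the function is `C¹`, hence only locally Lipschitz: its derivative may be unbounded. -/
lemma exists_locally_holder {d : ℕ} {β L : ℝ} (hL : 0 < L) {g : E d → ℝ}
    (hg : g ∈ holderClass d β L) (x₀ : E d) :
    ∃ K > 0, ∃ r > 0, ∀ x ∈ Metric.closedBall x₀ r, ∀ y ∈ Metric.closedBall x₀ r,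
      |g x - g y| ≤ K * ‖x - y‖ ^ min 1 β := by
  rcases le_or_gt β 1 with h | h
  · refine ⟨L, hL, 1, one_pos, fun x _ y _ => ?_⟩
    have := hg.2 y x
    rw [holderFloor_eq_zero h, taylorPoly_zero] at this
    rwa [min_eq_right h, norm_sub_rev]
  · have h1 : 1 ≤ holderFloor β := by
      have : 1 < ⌈β⌉₊ := Nat.lt_ceil.2 (by simpa using h)
      unfold holderFloor; omega
    have hc : ContDiff ℝ 1 g := hg.1.of_le (by exact_mod_cast h1)
    obtain ⟨K, t, ht, hK⟩ := hc.locallyLipschitz x₀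
    obtain ⟨r, hr, hrt⟩ := Metric.nhds_basis_closedBall.mem_iff.1 ht
    -- The Lipschitz constant may vanish; adding 1 makes it positive.
    refine ⟨K + 1, by positivity, r, hr, fun x hx y hy => ?_⟩
    have := hK.dist_le_mul x (hrt hx) y (hrt hy)
    rw [Real.dist_eq, dist_eq_norm] at this
    rw [min_eq_left h.le, Real.rpow_one]
    nlinarith [norm_nonneg (x - y)]

lemma StrongDensity.mul_volume_le {d : ℕ} {c₀ r₀ μmin μmax : ℝ} {C : Set (E d)} {Q : Measure (E d)}
    (h : StrongDensity c₀ r₀ μmin μmax C Q) {S : Set (E d)} (hS : MeasurableSet S)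
    (hSQ : S ⊆ Q.support) : ENNReal.ofReal μmin * volume S ≤ Q S := by
  obtain ⟨A, hA, -, -, μ, hμ, hQ, h1, h2⟩ := h
  have hsub : Q.support ⊆ A := by
    refine Measure.support_subset_of_isClosed hA.isClosed ?_
    rw [mem_ae_iff, hQ, withDensity_apply _ hA.isClosed.measurableSet.compl]
    rw [setLIntegral_congr_fun (g := 0) hA.isClosed.measurableSet.compl]
    · simp
    · intro x hx
      simp [h2 x hx]
  rw [hQ, withDensity_apply _ hS, ← setLIntegral_const]
  exact setLIntegral_mono' hS fun x hx => ENNReal.ofReal_le_ofReal (h1 x (hsub (hSQ hx))).1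

/-- Near an interior point of the support, a continuous regression function is Hölder continuous and
satisfies the margin condition with respect to Lebesgue measure. -/
lemma exists_local_bounds {d : ℕ} {α β L c₀ r₀ C₀ μmin μmax : ℝ} (hL : 0 < L) (hC₀ : 0 < C₀)
    (hμ : 0 < μmin) {C : Set (E d)} {P : ProbabilityMeasure (E d × Fin 2)}
    (hP : P ∈ lawClass α c₀ r₀ C₀ β L μmin μmax C) {η : E d → ℝ} (hη : IsRegressionFunction P η)
    (hηc : Continuous η) {x₀ : E d} (hx₀ : x₀ ∈ interior (marginal P).support) :
    ∃ R > 0, ∃ K > 0, ∃ K' > 0,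
      (∀ x ∈ Metric.closedBall x₀ R, ∀ y ∈ Metric.closedBall x₀ R,
        |η x - η y| ≤ K * ‖x - y‖ ^ min 1 β) ∧
      ∀ t : ℝ, 0 < t → ∀ S ⊆ Metric.closedBall x₀ R, MeasurableSet S →
        (∀ x ∈ S, 0 < |η x - 1 / 2| ∧ |η x - 1 / 2| ≤ t) →
          volume S ≤ ENNReal.ofReal (K' * t ^ α) := by
  obtain ⟨hsd, g, hg, hgH, hgM⟩ := hP
  -- The Hölder and margin bounds are given for `g` only; equality on the support carries them to
  -- `η`.
  have heq := hη.eqOn_support hg hηc (continuous_of_mem_holderClass hgH)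
  obtain ⟨K, hK, r, hr, hKr⟩ := exists_locally_holder hL hgH x₀
  obtain ⟨R₁, hR₁, hsub⟩ :=
    Metric.nhds_basis_closedBall.mem_iff.1 (mem_interior_iff_mem_nhds.1 hx₀)
  refine ⟨min r R₁, lt_min hr hR₁, K, hK, C₀ / μmin, div_pos hC₀ hμ, ?_, ?_⟩
  · intro x hx y hy
    rw [heq (hsub (Metric.closedBall_subset_closedBall (min_le_right _ _) hx)),
      heq (hsub (Metric.closedBall_subset_closedBall (min_le_right _ _) hy))]
    exact hKr x (Metric.closedBall_subset_closedBall (min_le_left _ _) hx) y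
      (Metric.closedBall_subset_closedBall (min_le_left _ _) hy)
  · intro t ht S hS hSm hSt
    have hSs : S ⊆ (marginal P).support :=
      hS.trans ((Metric.closedBall_subset_closedBall (min_le_right _ _)).trans hsub)
    have h1 := hsd.mul_volume_le hSm hSs
    have h2 : marginal P S ≤ ENNReal.ofReal (C₀ * t ^ α) := by
      refine (measure_mono fun x hx => ?_).trans (hgM t ht)
      have := hSt x hx
      rwa [heq (hSs hx)] at this
    have hpos : ENNReal.ofReal μmin ≠ 0 := by simpa using hμ
    have h3 : volume S ≤ ENNReal.ofReal (C₀ * t ^ α) / ENNReal.ofReal μmin := by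
      rw [ENNReal.le_div_iff_mul_le (Or.inl hpos) (Or.inl ENNReal.ofReal_ne_top), mul_comm]
      exact h1.trans h2
    rwa [← ENNReal.ofReal_div_of_pos hμ, mul_div_right_comm] at h3

/-! ### Impossibility of hitting and crossing -/

lemma volume_closedBall_eq {d : ℕ} (x : E d) {r : ℝ} (hr : 0 ≤ r) :
    volume (Metric.closedBall x r) =
      ENNReal.ofReal (r ^ d * (volume (Metric.closedBall (0 : E d) 1)).toReal) := by
  rw [Measure.addHaar_closedBall' _ _ hr, ENNReal.ofReal_mul (by positivity),
    ENNReal.ofReal_toReal measure_closedBall_lt_top.ne]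
  simp

lemma volume_closedBall_toReal_pos {d : ℕ} (x : E d) {r : ℝ} (hr : 0 < r) :
    0 < (volume (Metric.closedBall x r)).toReal :=
  ENNReal.toReal_pos (Metric.measure_closedBall_pos _ _ hr).ne' measure_closedBall_lt_top.ne

theorem not_hitsAt_of_local_bounds {d : ℕ} {α γ R K K' : ℝ} {η : E d → ℝ} {x₀ : E d}
    (hηc : Continuous η) (hγ : 0 < γ) (hR : 0 < R) (hK : 0 < K)
    (hK' : 0 < K')
    (hH : ∀ x ∈ Metric.closedBall x₀ R, ∀ y ∈ Metric.closedBall x₀ R,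
        |η x - η y| ≤ K * ‖x - y‖ ^ γ)
    (hM : ∀ t : ℝ, 0 < t → ∀ S ⊆ Metric.closedBall x₀ R, MeasurableSet S →
        (∀ x ∈ S, 0 < |η x - 1 / 2| ∧ |η x - 1 / 2| ≤ t) →
          volume S ≤ ENNReal.ofReal (K' * t ^ α))
    (hd : (d : ℝ) < α * γ) : ¬ HitsAt η (1 / 2) x₀ := by
  rintro ⟨h0, h1⟩
  obtain ⟨x, hx, hxne⟩ := h1 (R / 2) (by positivity)
  set v := (volume (Metric.closedBall (0 : E d) 1)).toReal with hv
  have hvpos : 0 < v := volume_closedBall_toReal_pos _ one_pos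
  have hpos : 0 < |η x - 1 / 2| := abs_pos.2 (sub_ne_zero.2 hxne)
  have e1 := eventually_mul_rpow_lt (C := 2 * K) hpos hγ
  have e2 := eventually_mul_rpow_lt_mul_rpow (C := K' * (4 * K) ^ α) hvpos hd
  have e3 : ∀ᶠ s : ℝ in 𝓝[>] 0, s < R / 2 :=
    nhdsWithin_le_nhds (gt_mem_nhds (by positivity))
  obtain ⟨s, ⟨⟨hs1, hs2⟩, hs3⟩, hs0⟩ := (((e1.and e2).and e3).and self_mem_nhdsWithin).exists
  have hs0 : 0 < s := hs0
  have hsγ : 0 < s ^ γ := Real.rpow_pos_of_pos hs0 γ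
  have hcont : Continuous fun x => |η x - 1 / 2| := by fun_prop
  -- The level `2 K s ^ γ` is twice the oscillation bound `K s ^ γ`, so on the ball of radius `s`
  -- about `y` the distance to `1/2` stays between `K s ^ γ` and `3 K s ^ γ`.
  obtain ⟨y, hy, hyt⟩ := (convex_closedBall x₀ (R / 2)).isPreconnected.intermediate_value
    (Metric.mem_closedBall_self (by positivity)) hx hcont.continuousOn
    (show 2 * K * s ^ γ ∈ Icc |η x₀ - 1 / 2| |η x - 1 / 2| from
      ⟨by rw [h0]; simp; positivity, hs1.le⟩)
  have hyR : Metric.closedBall y s ⊆ Metric.closedBall x₀ R :=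
    Metric.closedBall_subset_closedBall' (by have := Metric.mem_closedBall.1 hy; linarith)
  have hb := hM (4 * K * s ^ γ) (by positivity) _ hyR Metric.isClosed_closedBall.measurableSet (by
    intro z hz
    have h2 := hH z (hyR hz) y (hyR (Metric.mem_closedBall_self hs0.le))
    have h3 : ‖z - y‖ ^ γ ≤ s ^ γ :=
      Real.rpow_le_rpow (norm_nonneg _) (by simpa [dist_eq_norm] using hz) hγ.le
    have h4 : |η z - η y| ≤ K * s ^ γ := h2.trans (mul_le_mul_of_nonneg_left h3 hK.le)
    have h5 := abs_abs_sub_abs_le_abs_sub (η z - 1 / 2) (η y - 1 / 2)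
    rw [sub_sub_sub_cancel_right] at h5
    have h6 := abs_le.1 (h5.trans h4)
    simp only at hyt
    have : 0 < K * s ^ γ := by positivity
    constructor <;> linarith [h6.1, h6.2])
  rw [volume_closedBall_eq _ hs0.le, ENNReal.ofReal_le_ofReal_iff (by positivity),
    Real.mul_rpow (by positivity) hsγ.le, ← Real.rpow_mul hs0.le, ← Real.rpow_natCast] at hb
  rw [mul_comm α γ] at hs2
  rw [← mul_assoc, mul_comm] at hb
  linarith

/-- If every translate by `v ∈ B` of the segment with direction `w` meets `S` in a set of length at
least `δ`, then `S` has volume at least `volume B * δ / 2`. -/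
lemma volume_mul_le_of_forall_segment {d : ℕ} {S B : Set (E d)} (hS : MeasurableSet S)
    (hB : MeasurableSet B) (a w : E d) (δ : ENNReal)
    (h : ∀ v ∈ B, δ ≤ volume {s : ℝ | s ∈ Icc (0 : ℝ) 2 ∧ a + v + s • w ∈ S}) :
    δ * volume B ≤ 2 * volume S := by
  have hm : Measurable fun p : E d × ℝ => S.indicator (1 : E d → ENNReal) (a + p.1 + p.2 • w) :=
    (measurable_one.indicator hS).comp (by fun_prop)
  calc δ * volume B = ∫⁻ _ in B, δ := by rw [setLIntegral_const]
    _ ≤ ∫⁻ v in B, ∫⁻ s in Icc (0 : ℝ) 2, S.indicator (1 : E d → ENNReal) (a + v + s • w) := by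
      refine setLIntegral_mono' hB fun v hv => (h v hv).trans ?_
      have hmS : MeasurableSet {s : ℝ | a + v + s • w ∈ S} := by
        have : Measurable fun s : ℝ => a + v + s • w := by fun_prop
        exact this hS
      calc volume {s : ℝ | s ∈ Icc (0 : ℝ) 2 ∧ a + v + s • w ∈ S}
          = (volume.restrict (Icc (0 : ℝ) 2)) {s : ℝ | a + v + s • w ∈ S} := by
            rw [Measure.restrict_apply hmS, inter_comm]; rfl
        _ = ∫⁻ s in Icc (0 : ℝ) 2, {s : ℝ | a + v + s • w ∈ S}.indicator 1 s :=
            (lintegral_indicator_one hmS).symm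
        _ ≤ _ := le_of_eq rfl
    _ = ∫⁻ s in Icc (0 : ℝ) 2, ∫⁻ v in B, S.indicator (1 : E d → ENNReal) (a + v + s • w) :=
      lintegral_lintegral_swap hm.aemeasurable
    _ ≤ ∫⁻ _ in Icc (0 : ℝ) 2, volume S := by
      refine lintegral_mono fun s => ?_
      refine (setLIntegral_le_lintegral _ _).trans ?_
      -- For fixed `s`, translation invariance bounds the inner integral by the volume of `S`.
      have := lintegral_add_left_eq_self (μ := (volume : Measure (E d)))
        (S.indicator (1 : E d → ENNReal)) (a + s • w)
      rw [lintegral_indicator_one hS] at this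
      rw [← this]
      refine lintegral_mono fun v => le_of_eq ?_
      simp only [add_right_comm]
    _ = 2 * volume S := by
      rw [setLIntegral_const, Real.volume_Icc, mul_comm]
      norm_num

theorem not_crossesAt_of_local_bounds {d : ℕ} {α γ R K K' : ℝ} {η : E d → ℝ} {x₀ : E d}
    (hηc : Continuous η) (hγ : 0 < γ) (hR : 0 < R) (hK : 0 < K)
    (hK' : 0 < K')
    (hH : ∀ x ∈ Metric.closedBall x₀ R, ∀ y ∈ Metric.closedBall x₀ R,
        |η x - η y| ≤ K * ‖x - y‖ ^ γ)
    (hM : ∀ t : ℝ, 0 < t → ∀ S ⊆ Metric.closedBall x₀ R, MeasurableSet S →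
        (∀ x ∈ S, 0 < |η x - 1 / 2| ∧ |η x - 1 / 2| ≤ t) →
          volume S ≤ ENNReal.ofReal (K' * t ^ α))
    (hd : 1 < α * γ) : ¬ CrossesAt η (1 / 2) x₀ := by
  intro hcr
  obtain ⟨a, ha, b, hb, hηa, hηb⟩ := hcr (R / 8) (by positivity)
  set ε := (η b - 1 / 2) / 2 with hε
  have hεpos : 0 < ε := by rw [hε]; linarith
  have hbε : 1 / 2 + ε < η b := by rw [hε]; linarith
  obtain ⟨ρ₁, hρ₁, hsub₁⟩ := Metric.nhds_basis_closedBall.mem_iff.1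
    (hηc.continuousAt.preimage_mem_nhds (Iio_mem_nhds hηa))
  obtain ⟨ρ₂, hρ₂, hsub₂⟩ := Metric.nhds_basis_closedBall.mem_iff.1
    (hηc.continuousAt.preimage_mem_nhds (Ioi_mem_nhds hbε))
  -- The `R / 8` keeps the tube inside the big ball: `R/8 + R/8 + 2 * (R/4) ≤ R`. The segment
  -- parameter runs to 2, so that a stretch of length `δ < 1` starting in `[0, 1]` fits.
  set ρ := min (min ρ₁ ρ₂) (R / 8) with hρ
  have hρpos : 0 < ρ := lt_min (lt_min hρ₁ hρ₂) (by positivity)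
  set w := b - a with hw
  have hwpos : 0 < ‖w‖ := by
    rw [norm_pos_iff, hw, sub_ne_zero]
    rintro rfl
    linarith
  have haR : ‖a - x₀‖ ≤ R / 8 := by simpa [dist_eq_norm] using ha
  have hbR : ‖b - x₀‖ ≤ R / 8 := by simpa [dist_eq_norm] using hb
  have hwR : ‖w‖ ≤ R / 4 := by
    rw [hw, ← sub_sub_sub_cancel_right b a x₀]
    linarith [norm_sub_le (b - x₀) (a - x₀)]
  set v := (volume (Metric.closedBall (0 : E d) ρ)).toReal with hv
  have hvpos : 0 < v := volume_closedBall_toReal_pos _ hρpos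
  have e1 := eventually_mul_rpow_lt (C := 2 * K * ‖w‖ ^ γ) hεpos hγ
  have e2 := eventually_mul_rpow_lt_mul_rpow (C := 2 * (K' * (4 * K * ‖w‖ ^ γ) ^ α)) hvpos hd
  have e3 : ∀ᶠ s : ℝ in 𝓝[>] 0, s < 1 := nhdsWithin_le_nhds (gt_mem_nhds one_pos)
  obtain ⟨δ, ⟨⟨hδ1, hδ2⟩, hδ3⟩, hδ0⟩ := (((e1.and e2).and e3).and self_mem_nhdsWithin).exists
  have hδ0 : 0 < δ := hδ0
  have hδγ : 0 < δ ^ γ := Real.rpow_pos_of_pos hδ0 γ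
  have hwγ : 0 < ‖w‖ ^ γ := Real.rpow_pos_of_pos hwpos γ
  have hcont : Continuous fun x => |η x - 1 / 2| := by fun_prop
  set κ := K * ‖w‖ ^ γ * δ ^ γ with hκ
  have hκpos : 0 < κ := by positivity
  set S := Metric.closedBall x₀ R ∩ (fun x => |η x - 1 / 2|) ⁻¹' Ioc 0 (4 * κ) with hS
  have hSm : MeasurableSet S :=
    Metric.isClosed_closedBall.measurableSet.inter (hcont.measurable measurableSet_Ioc)
  have hball : ∀ u ∈ Metric.closedBall (0 : E d) ρ, ∀ s ∈ Icc (0 : ℝ) 2,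
      a + u + s • w ∈ Metric.closedBall x₀ R := by
    intro u hu s hs
    have hu : ‖u‖ ≤ R / 8 := by
      have : ‖u‖ ≤ ρ := by simpa using hu
      exact this.trans (min_le_right _ _)
    rw [Metric.mem_closedBall, dist_eq_norm]
    have h1 : a + u + s • w - x₀ = (a - x₀) + u + s • w := by abel
    have h2 : ‖s • w‖ ≤ 2 * (R / 4) := by
      rw [norm_smul, Real.norm_of_nonneg hs.1]
      exact mul_le_mul hs.2 hwR hwpos.le (by norm_num)
    rw [h1]
    linarith [norm_add₃_le (a := a - x₀) (b := u) (c := s • w)]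
  have key := volume_mul_le_of_forall_segment hSm
    (Metric.isClosed_closedBall (x := (0 : E d)) (ε := ρ)).measurableSet a w (ENNReal.ofReal δ) (by
      intro u hu
      have hu' : ‖u‖ ≤ ρ := by simpa using hu
      have hlo : η (a + u + (0 : ℝ) • w) < 1 / 2 := by
        apply hsub₁
        simpa using hu'.trans ((min_le_left _ _).trans (min_le_left _ _))
      have hhi : 1 / 2 + ε < η (a + u + (1 : ℝ) • w) := by
        have : a + u + (1 : ℝ) • w = b + u := by rw [hw, one_smul]; abel
        rw [this]
        apply hsub₂
        simpa using hu'.trans ((min_le_left _ _).trans (min_le_right _ _))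
      have hcs : Continuous fun s : ℝ => η (a + u + s • w) := by fun_prop
      -- Over a parameter length `δ` the function varies by at most `κ`; starting at height `2κ`
      -- above `1/2` it stays between `κ` and `3κ`.
      obtain ⟨s₀, hs₀, hs₀t⟩ := intermediate_value_Icc (zero_le_one (α := ℝ)) hcs.continuousOn
        (show 1 / 2 + 2 * κ ∈ _ from ⟨by linarith, by rw [hκ]; linarith⟩)
      have hsub : Icc s₀ (s₀ + δ) ⊆ {s : ℝ | s ∈ Icc (0 : ℝ) 2 ∧ a + u + s • w ∈ S} := by
        intro s hs
        have hs2 : s ∈ Icc (0 : ℝ) 2 := ⟨hs₀.1.trans hs.1, by linarith [hs.2, hs₀.2]⟩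
        refine ⟨hs2, hball u hu s hs2, ?_⟩
        have h2 := hH _ (hball u hu s hs2) _ (hball u hu s₀ ⟨hs₀.1, by linarith [hs₀.2]⟩)
        have h3 : ‖a + u + s • w - (a + u + s₀ • w)‖ ^ γ ≤ ‖w‖ ^ γ * δ ^ γ := by
          rw [add_sub_add_left_eq_sub, ← sub_smul, norm_smul, ← Real.mul_rpow hwpos.le hδ0.le,
            mul_comm]
          refine Real.rpow_le_rpow (by positivity) ?_ hγ.le
          refine mul_le_mul_of_nonneg_left ?_ hwpos.le
          rw [Real.norm_of_nonneg (by linarith [hs.1])]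
          linarith [hs.2]
        have h4 := h2.trans (mul_le_mul_of_nonneg_left h3 hK.le)
        rw [← mul_assoc, ← hκ, abs_le] at h4
        simp only at hs₀t
        have h5 : 0 < η (a + u + s • w) - 1 / 2 := by linarith [h4.1]
        simp only [mem_preimage, mem_Ioc, abs_of_pos h5]
        exact ⟨h5, by linarith [h4.2]⟩
      refine le_trans ?_ (measure_mono hsub)
      rw [Real.volume_Icc, add_sub_cancel_left])
  have hSv := hM (4 * κ) (by positivity) S inter_subset_left hSm fun x hx => hx.2
  have h6 : ENNReal.ofReal (δ * v) ≤ ENNReal.ofReal (2 * (K' * (4 * κ) ^ α)) := by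
    rw [ENNReal.ofReal_mul hδ0.le, hv, ENNReal.ofReal_toReal measure_closedBall_lt_top.ne,
      ENNReal.ofReal_mul (by norm_num)]
    refine key.trans ?_
    rw [ENNReal.ofReal_ofNat]
    gcongr
  rw [ENNReal.ofReal_le_ofReal_iff (by positivity), hκ,
    show 4 * (K * ‖w‖ ^ γ * δ ^ γ) = 4 * K * ‖w‖ ^ γ * δ ^ γ by ring,
    Real.mul_rpow (by positivity) hδγ.le, ← Real.rpow_mul hδ0.le] at h6
  rw [mul_comm α γ, Real.rpow_one] at hδ2
  linarith

/-! ### Laws with uniform marginal on a convex body -/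

/-- Shrinking `A` towards `x` by the factor `r / D` stays in `A` by convexity and lands in the ball
of radius `r`. The image has volume `(r / D) ^ d` times that of `A`. -/
lemma exists_isRegularSet_of_convex {d : ℕ} {A : Set (E d)} (hA : IsCompact A) (hc : Convex ℝ A)
    (hv : volume A ≠ 0) : ∃ c₀ > 0, ∃ r₀ > 0, IsRegularSet c₀ r₀ A := by
  set D := Metric.diam A + 1 with hD
  have hDpos : 0 < D := by have := Metric.diam_nonneg (s := A); linarith
  set v := (volume (Metric.closedBall (0 : E d) 1)).toReal with hvdef
  have hvpos : 0 < v := volume_closedBall_toReal_pos _ one_pos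
  have hApos : 0 < (volume A).toReal := ENNReal.toReal_pos hv hA.measure_lt_top.ne
  refine ⟨(volume A).toReal / (D ^ d * v), by positivity, D, hDpos,
    hA.isClosed.measurableSet.nullMeasurableSet, fun x hx r hr hrD => ?_⟩
  have hsub : AffineMap.homothety x (r / D) '' A ⊆ A ∩ Metric.closedBall x r := by
    rintro _ ⟨y, hy, rfl⟩
    have hrD' : r / D ∈ Icc (0 : ℝ) 1 := ⟨by positivity, (div_le_one hDpos).2 hrD⟩
    rw [AffineMap.homothety_eq_lineMap]
    refine ⟨?_, ?_⟩
    · exact hc.lineMap_mem hx hy hrD'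
    · rw [Metric.mem_closedBall, dist_lineMap_left, Real.norm_of_nonneg hrD'.1]
      have : dist x y ≤ D := (Metric.dist_le_diam_of_mem hA.isBounded hx hy).trans (by linarith)
      calc r / D * dist x y ≤ r / D * D := mul_le_mul_of_nonneg_left this hrD'.1
        _ = r := by field_simp
  refine le_trans ?_ (measure_mono hsub)
  rw [Measure.addHaar_image_homothety, volume_closedBall_eq _ hr.le,
    ← ENNReal.ofReal_mul (by positivity), finrank_euclideanSpace_fin, abs_of_pos (by positivity)]
  nth_rw 2 [← ENNReal.ofReal_toReal (hA.measure_lt_top (μ := volume)).ne]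
  rw [← ENNReal.ofReal_mul (by positivity)]
  refine ENNReal.ofReal_le_ofReal (le_of_eq ?_)
  rw [← hvdef, div_pow]
  field_simp

/-- The Markov kernel with `Y = 1` having probability `g x` given `X = x`. -/
lemma exists_kernel_real_eq {X : Type*} [MeasurableSpace X] {g : X → ℝ} (hg : Measurable g)
    (h01 : ∀ x, g x ∈ Icc (0 : ℝ) 1) :
    ∃ κ : Kernel X (Fin 2), IsMarkovKernel κ ∧ ∀ x, (κ x).real {1} = g x := by
  refine ⟨⟨fun x => ENNReal.ofReal (g x) • Measure.dirac 1 +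
    ENNReal.ofReal (1 - g x) • Measure.dirac 0, ?_⟩, ⟨fun x => ⟨?_⟩⟩, fun x => ?_⟩
  · refine Measure.measurable_of_measurable_coe _ fun s hs => ?_
    simp only [Measure.coe_add, Measure.coe_smul, Pi.add_apply, Pi.smul_apply, smul_eq_mul]
    fun_prop
  · simp only [Kernel.coe_mk, Measure.coe_add, Measure.coe_smul, Pi.add_apply, Pi.smul_apply,
      smul_eq_mul, measure_univ, mul_one]
    rw [← ENNReal.ofReal_add (h01 x).1 (by linarith [(h01 x).2])]
    simp
  · simp only [Measure.real, Kernel.coe_mk, Measure.coe_add, Measure.coe_smul, Pi.add_apply,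
      Pi.smul_apply, smul_eq_mul]
    simp [(h01 x).1]

lemma exists_probabilityMeasure_isRegressionFunction {d : ℕ} (Q : Measure (E d))
    [IsProbabilityMeasure Q] {g : E d → ℝ} (hg : Measurable g) (h01 : ∀ x, g x ∈ Icc (0 : ℝ) 1) :
    ∃ P : ProbabilityMeasure (E d × Fin 2), marginal P = Q ∧ IsRegressionFunction P g := by
  obtain ⟨κ, hκ, hκg⟩ := exists_kernel_real_eq hg h01
  refine ⟨⟨Q.compProd κ, inferInstance⟩, Measure.fst_compProd Q κ, hg, h01, ?_⟩
  have h := condKernel_compProd Q κ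
  change ∀ᵐ x ∂(Q.compProd κ).fst, g x = ((Q.compProd κ).condKernel x).real {1}
  rw [Measure.fst_compProd]
  filter_upwards [h] with x hx
  rw [hx, hκg]

/-- A law with uniform marginal on a convex body and prescribed regression function. -/
theorem exists_mem_lawClass_of_convex {d : ℕ} {α β L C₁ : ℝ} (hα : 0 ≤ α) (hC₁ : 0 < C₁)
    {C A : Set (E d)} (hA : IsCompact A) (hAC : A ⊆ C) (hc : Convex ℝ A)
    (hi : (interior A).Nonempty) {g : E d → ℝ} (hg : g ∈ holderClass d β L)
    (h01 : ∀ x, g x ∈ Icc (0 : ℝ) 1)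
    (hM : ∀ t : ℝ, 0 < t → t ≤ 1 →
      volume (A ∩ {x | 0 < |g x - 1 / 2| ∧ |g x - 1 / 2| ≤ t}) ≤ ENNReal.ofReal (C₁ * t ^ α)) :
    ∃ c₀ r₀ C₀ μmin μmax : ℝ, 0 < c₀ ∧ 0 < r₀ ∧ 0 < C₀ ∧ 0 < μmin ∧ μmin < μmax ∧
      ∃ P ∈ lawClass α c₀ r₀ C₀ β L μmin μmax C, (marginal P).support = A ∧
        ∀ η : E d → ℝ, IsRegressionFunction P η → Continuous η → EqOn η g A := by
  have hvol : volume A ≠ 0 :=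
    ((isOpen_interior.measure_pos volume hi).trans_le (measure_mono interior_subset)).ne'
  have hvol' : volume A ≠ ⊤ := hA.measure_lt_top.ne
  obtain ⟨c₀, hc₀, r₀, hr₀, hreg⟩ := exists_isRegularSet_of_convex hA hc hvol
  have hAm := hA.isClosed.measurableSet
  have hApos : 0 < (volume A).toReal := ENNReal.toReal_pos hvol hvol'
  set m := (volume A).toReal⁻¹ with hm
  have hmpos : 0 < m := inv_pos.2 hApos
  set μ : E d → ℝ := A.indicator fun _ => m with hμ
  set Q : Measure (E d) := volume.withDensity fun x => ENNReal.ofReal (μ x) with hQ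
  have hQeq : Q = ENNReal.ofReal m • volume.restrict A := by
    rw [hQ, ← withDensity_const, ← withDensity_indicator hAm]
    congr 1
    ext x
    by_cases hx : x ∈ A <;> simp [hμ, hx]
  have hmvol : ENNReal.ofReal m * volume A = 1 := by
    rw [hm, ENNReal.ofReal_inv_of_pos hApos, ENNReal.ofReal_toReal hvol',
      ENNReal.inv_mul_cancel hvol hvol']
  have hQp : IsProbabilityMeasure Q := ⟨by rw [hQeq]; simpa using hmvol⟩
  have hsupp : Q.support = A := by
    refine Subset.antisymm (Measure.support_subset_of_isClosed hA.isClosed ?_) fun x hx => ?_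
    · rw [mem_ae_iff, hQeq]
      simp [hAm.compl]
    -- Regularity of `A` gives every small ball about a point of `A` positive mass.
    · rw [Measure.mem_support_iff_forall]
      intro U hU
      obtain ⟨ρ, hρ, hsub⟩ := Metric.nhds_basis_closedBall.mem_iff.1 hU
      refine lt_of_lt_of_le ?_ (measure_mono
        ((Metric.closedBall_subset_closedBall (min_le_left ρ r₀)).trans hsub))
      have hρ' : 0 < min ρ r₀ := lt_min hρ hr₀
      rw [hQeq, Measure.smul_apply, Measure.restrict_apply Metric.isClosed_closedBall.measurableSet,
        inter_comm]
      refine ENNReal.mul_pos (by simpa using hmpos) ?_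
      refine ((ENNReal.mul_pos ?_ ?_).trans_le (hreg.2 x hx _ hρ' (min_le_right _ _))).ne'
      · simpa using hc₀
      · exact (Metric.measure_closedBall_pos _ _ hρ').ne'
  have hgc := continuous_of_mem_holderClass hg
  obtain ⟨P, hPQ, hPg⟩ := exists_probabilityMeasure_isRegressionFunction Q hgc.measurable h01
  have hC₀ : 0 < 1 + m * C₁ := by positivity
  -- In the margin constant, `m * C₁` serves `t ≤ 1` and the summand 1 serves `t > 1`, where `t ^ α
  -- ≥ 1` bounds any probability. The density is `m` on `A`; `m / 2` only makes `μmin < μmax`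
  -- strict.
  refine ⟨c₀, r₀, 1 + m * C₁, m / 2, m, hc₀, hr₀, hC₀, by positivity, by linarith,
    P, ⟨?_, g, hPg, hg, ?_⟩, by rw [hPQ, hsupp], fun η hη hηc => ?_⟩
  · rw [hPQ]
    refine ⟨A, hA, hAC, hreg, μ, measurable_const.indicator hAm, hQ, fun x hx => ?_, fun x hx => ?_⟩
    · simp only [hμ, indicator_of_mem hx]
      exact ⟨by linarith, le_rfl⟩
    · simp [hμ, hx]
  · rw [hPQ]
    intro t ht
    rcases le_or_gt t 1 with ht1 | ht1
    · have hms : MeasurableSet {x | 0 < |g x - 1 / 2| ∧ |g x - 1 / 2| ≤ t} := by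
        have : Measurable fun x => |g x - 1 / 2| := by
          have : Continuous fun x => |g x - 1 / 2| := by fun_prop
          exact this.measurable
        exact this measurableSet_Ioc
      rw [hQeq, Measure.smul_apply, Measure.restrict_apply hms, inter_comm, smul_eq_mul]
      refine (mul_le_mul_right (hM t ht ht1) _).trans ?_
      rw [← ENNReal.ofReal_mul hmpos.le]
      refine ENNReal.ofReal_le_ofReal ?_
      have : 0 ≤ t ^ α := by positivity
      nlinarith
    · refine prob_le_one.trans ?_
      rw [← ENNReal.ofReal_one]
      refine ENNReal.ofReal_le_ofReal ?_
      have h1 : 1 ≤ t ^ α := Real.one_le_rpow ht1.le hα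
      have : 0 < m * C₁ := by positivity
      nlinarith
  · have := hη.eqOn_support hPg hηc hgc
    rwa [hPQ, hsupp] at this

/-! ### Membership in the Hölder class -/

lemma mem_holderClass_mono {d : ℕ} {β L L' : ℝ} (h : L ≤ L') {g : E d → ℝ}
    (hg : g ∈ holderClass d β L) : g ∈ holderClass d β L' :=
  ⟨hg.1, fun x x' => (hg.2 x x').trans
    (mul_le_mul_of_nonneg_right h (Real.rpow_nonneg (norm_nonneg _) _))⟩

lemma taylorPoly_add {d l : ℕ} {f g : E d → ℝ} (hf : ContDiff ℝ l f) (hg : ContDiff ℝ l g)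
    (x x' : E d) :
    taylorPoly l (fun y => f y + g y) x x' = taylorPoly l f x x' + taylorPoly l g x x' := by
  unfold taylorPoly
  rw [← Finset.sum_add_distrib]
  refine Finset.sum_congr rfl fun k hk => ?_
  have hk : (k : WithTop ℕ∞) ≤ l := by exact_mod_cast Nat.lt_succ_iff.1 (Finset.mem_range.1 hk)
  have := iteratedFDeriv_add_apply (hf.of_le hk).contDiffAt (hg.of_le hk).contDiffAt (x := x)
  rw [show (fun y => f y + g y) = f + g from rfl, this]
  simp [mul_add]

lemma taylorPoly_const_mul {d l : ℕ} {f : E d → ℝ} (hf : ContDiff ℝ l f) (c : ℝ)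
    (x x' : E d) : taylorPoly l (fun y => c * f y) x x' = c * taylorPoly l f x x' := by
  unfold taylorPoly
  rw [Finset.mul_sum]
  refine Finset.sum_congr rfl fun k hk => ?_
  have hk : (k : WithTop ℕ∞) ≤ l := by exact_mod_cast Nat.lt_succ_iff.1 (Finset.mem_range.1 hk)
  have := iteratedFDeriv_const_smul_apply (a := c) (hf.of_le hk).contDiffAt (x := x)
  rw [show (fun y => c * f y) = c • f from rfl, this]
  simp [mul_left_comm]

lemma taylorPoly_const {d l : ℕ} (c : ℝ) (x x' : E d) :
    taylorPoly l (fun _ => c) x x' = c := by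
  unfold taylorPoly
  rw [Finset.sum_eq_single_of_mem 0 (by simp)]
  · simp
  · intro k _ hk
    rw [iteratedFDeriv_const_of_ne hk]
    simp

lemma const_mem_holderClass {d : ℕ} (β c : ℝ) : (fun _ : E d => c) ∈ holderClass d β 0 :=
  ⟨contDiff_const, fun x x' => by simp [taylorPoly_const]⟩

lemma add_mem_holderClass {d : ℕ} {β L L' : ℝ} {f g : E d → ℝ}
    (hf : f ∈ holderClass d β L) (hg : g ∈ holderClass d β L') :
    (fun x => f x + g x) ∈ holderClass d β (L + L') := by
  refine ⟨hf.1.add hg.1, fun x x' => ?_⟩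
  rw [taylorPoly_add hf.1 hg.1, add_sub_add_comm, add_mul]
  exact (abs_add_le _ _).trans (add_le_add (hf.2 x x') (hg.2 x x'))

lemma const_mul_mem_holderClass {d : ℕ} {β L : ℝ} {f : E d → ℝ}
    (hf : f ∈ holderClass d β L) (c : ℝ) :
    (fun x => c * f x) ∈ holderClass d β (|c| * L) := by
  refine ⟨contDiff_const.mul hf.1, fun x x' => ?_⟩
  rw [taylorPoly_const_mul hf.1, ← mul_sub, abs_mul, mul_assoc]
  exact mul_le_mul_of_nonneg_left (hf.2 x x') (abs_nonneg c)

lemma sum_mem_holderClass {d : ℕ} {β L : ℝ} {ι : Type*} (s : Finset ι) {f : ι → E d → ℝ}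
    (hf : ∀ i, f i ∈ holderClass d β L) :
    (fun x => ∑ i ∈ s, f i x) ∈ holderClass d β (s.card * L) := by
  classical
  induction s using Finset.induction_on with
  | empty => simpa using const_mem_holderClass β 0
  | insert i s his ih =>
    have := add_mem_holderClass (hf i) ih
    simp only [Finset.sum_insert his]
    convert this using 2
    rw [Finset.card_insert_of_notMem his]
    push_cast
    ring

lemma taylorPoly_comp_proj {d l : ℕ} {f : ℝ → ℝ} (hf : ContDiff ℝ l f) (i : Fin d) (x x' : E d) :
    taylorPoly l (fun y : E d => f (y i)) x x' =
      ∑ k ∈ Finset.range (l + 1),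
        ((k.factorial : ℝ))⁻¹ * ((x' i - x i) ^ k * iteratedDeriv k f (x i)) := by
  unfold taylorPoly
  refine Finset.sum_congr rfl fun k hk => ?_
  have hk : (k : WithTop ℕ∞) ≤ l := by exact_mod_cast Nat.lt_succ_iff.1 (Finset.mem_range.1 hk)
  have := (EuclideanSpace.proj i : E d →L[ℝ] ℝ).iteratedFDeriv_comp_right
    hf x hk
  rw [show (fun y : E d => f (y i)) =
    f ∘ (EuclideanSpace.proj i : E d →L[ℝ] ℝ) from rfl, this]
  simp [iteratedFDeriv_apply_eq_iteratedDeriv_mul_prod]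

/-- Taylor remainder of a function all of whose derivatives are bounded by `1`. -/
lemma abs_sub_taylorSum_le {f : ℝ → ℝ} (hf : ∀ n : ℕ, ContDiff ℝ n f)
    (hb : ∀ n x, |iteratedDeriv n f x| ≤ 1) (n : ℕ) (x y : ℝ) :
    |f y - ∑ k ∈ Finset.range n, ((k.factorial : ℝ))⁻¹ * ((y - x) ^ k * iteratedDeriv k f x)|
      ≤ |y - x| ^ n := by
  cases n with
  | zero => simpa using hb 0 y
  | succ n =>
    rcases eq_or_ne x y with rfl | hxy
    · rw [Finset.sum_eq_single_of_mem 0 (by simp)]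
      · simp
      · intro k _ hk
        simp [hk]
    · obtain ⟨z, -, hz⟩ := taylor_mean_remainder_lagrange_iteratedDeriv (n := n) hxy
        (by exact_mod_cast (hf (n + 1)).contDiffOn)
      have hT : taylorWithinEval f n (uIcc x y) x y =
          ∑ k ∈ Finset.range (n + 1),
            ((k.factorial : ℝ))⁻¹ * ((y - x) ^ k * iteratedDeriv k f x) := by
        rw [taylor_within_apply]
        refine Finset.sum_congr rfl fun k _ => ?_
        rw [iteratedDerivWithin_eq_iteratedDeriv (uniqueDiffOn_uIcc hxy) (hf k).contDiffAt
          left_mem_uIcc, smul_eq_mul, mul_assoc]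
      rw [← hT, hz, abs_div, abs_mul, abs_pow]
      have h1 : (1 : ℝ) ≤ |((n + 1).factorial : ℝ)| := by
        rw [Nat.abs_cast]
        exact_mod_cast Nat.one_le_iff_ne_zero.2 (Nat.factorial_ne_zero _)
      refine (div_le_self (by positivity) h1).trans ?_
      exact mul_le_of_le_one_left (by positivity) (hb _ _)

lemma holderFloor_lt {β : ℝ} (hβ : 0 < β) : (holderFloor β : ℝ) < β := by
  have h : 0 < ⌈β⌉₊ := Nat.ceil_pos.2 hβ
  exact Nat.lt_ceil.1 (by unfold holderFloor; omega)

lemma le_holderFloor_add_one (β : ℝ) : β ≤ (holderFloor β : ℝ) + 1 := by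
  have : ⌈β⌉₊ ≤ holderFloor β + 1 := by unfold holderFloor; omega
  exact_mod_cast Nat.ceil_le.1 this

lemma abs_coord_le_norm {d : ℕ} (x : E d) (i : Fin d) : |x i| ≤ ‖x‖ := PiLp.norm_apply_le x i

/-- With `l < β ≤ l + 1`, a coordinate increment `h ≤ 1` has remainder at most `h ^ (l + 1) ≤ h ^
β`. For `h ≥ 1` the top Taylor term is split off: it and the remainder of order `l` are each at most
`h ^ l ≤ h ^ β`, whence the constant 2. -/
lemma comp_proj_mem_holderClass {d : ℕ} {β : ℝ} (hβ : 0 < β) {f : ℝ → ℝ}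
    (hf : ∀ n : ℕ, ContDiff ℝ n f) (hb : ∀ n x, |iteratedDeriv n f x| ≤ 1) (i : Fin d) :
    (fun x : E d => f (x i)) ∈ holderClass d β 2 := by
  set l := holderFloor β with hl
  refine ⟨(hf l).comp (EuclideanSpace.proj i : E d →L[ℝ] ℝ).contDiff,
    fun x x' => ?_⟩
  rw [taylorPoly_comp_proj (hf _)]
  have hh : |x' i - x i| ≤ ‖x - x'‖ := by
    rw [norm_sub_rev]
    exact abs_coord_le_norm (x' - x) i
  refine le_trans ?_ (mul_le_mul_of_nonneg_left
    (Real.rpow_le_rpow (abs_nonneg _) hh hβ.le) zero_le_two)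
  set h := |x' i - x i| with hh'
  have hpos : 0 ≤ h := abs_nonneg _
  rcases le_total h 1 with h1 | h1
  · refine (abs_sub_taylorSum_le hf hb _ _ _).trans ?_
    have h2 : h ^ (l + 1) ≤ h ^ β := by
      rw [← Real.rpow_natCast]
      refine Real.rpow_le_rpow_of_exponent_ge' hpos h1 hβ.le ?_
      push_cast
      exact le_holderFloor_add_one β
    have : 0 ≤ h ^ β := Real.rpow_nonneg hpos _
    linarith
  · rw [Finset.sum_range_succ, ← sub_sub]
    have h2 : h ^ l ≤ h ^ β := by
      rw [← Real.rpow_natCast]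
      exact Real.rpow_le_rpow_of_exponent_le h1 (holderFloor_lt hβ).le
    have h3 : |((l.factorial : ℝ))⁻¹ * ((x' i - x i) ^ l * iteratedDeriv l f (x i))| ≤ h ^ l := by
      rw [abs_mul, abs_mul, abs_pow, ← hh', abs_inv, Nat.abs_cast]
      have h4 : ((l.factorial : ℝ))⁻¹ ≤ 1 :=
        inv_le_one_of_one_le₀ (by exact_mod_cast Nat.one_le_iff_ne_zero.2 (Nat.factorial_ne_zero _))
      refine (mul_le_of_le_one_left (by positivity) h4).trans ?_
      exact mul_le_of_le_one_right (by positivity) (hb _ _)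
    have h5 := abs_sub_taylorSum_le hf hb l (x i) (x' i)
    refine (abs_sub _ _).trans ?_
    rw [← hh'] at h5
    linarith

lemma sin_sub_mem_holderClass {d : ℕ} {β : ℝ} (hβ : 0 < β) (a : ℝ) (i : Fin d) :
    (fun x : E d => Real.sin (x i - a)) ∈ holderClass d β 2 := by
  refine comp_proj_mem_holderClass hβ (f := fun y => Real.sin (y - a)) (fun n => ?_)
    (fun n x => ?_) i
  · exact Real.contDiff_sin.comp (contDiff_id.sub contDiff_const)
  · rw [iteratedDeriv_comp_sub_const]
    exact Real.abs_iteratedDeriv_sin_le_one _ _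

lemma cos_sub_mem_holderClass {d : ℕ} {β : ℝ} (hβ : 0 < β) (a : ℝ) (i : Fin d) :
    (fun x : E d => Real.cos (x i - a)) ∈ holderClass d β 2 := by
  refine comp_proj_mem_holderClass hβ (f := fun y => Real.cos (y - a)) (fun n => ?_)
    (fun n x => ?_) i
  · exact Real.contDiff_cos.comp (contDiff_id.sub contDiff_const)
  · rw [iteratedDeriv_comp_sub_const]
    exact Real.abs_iteratedDeriv_cos_le_one _ _

/-- This is subadditivity of the power `p ≤ 1`, applied to `a = (a - b) + b`. -/
lemma abs_rpow_sub_rpow_le {a b p : ℝ} (ha : 0 ≤ a) (hb : 0 ≤ b) (hp : 0 ≤ p) (hp1 : p ≤ 1) :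
    |a ^ p - b ^ p| ≤ |a - b| ^ p := by
  wlog h : b ≤ a generalizing a b
  · rw [abs_sub_comm, abs_sub_comm a]
    exact this hb ha (le_of_not_ge h)
  rw [abs_of_nonneg (sub_nonneg.2 (Real.rpow_le_rpow hb h hp)), abs_of_nonneg (sub_nonneg.2 h)]
  have := Real.rpow_add_le_add_rpow (sub_nonneg.2 h) hb hp hp1
  rw [sub_add_cancel] at this
  linarith

/-- The odd function equal to `y ^ p` on `[0, 1]` and to `1` on `[1, ∞)`. -/
noncomputable def oddPow (p y : ℝ) : ℝ := max 0 (min y 1) ^ p - max 0 (min (-y) 1) ^ p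

lemma oddPow_of_mem {p y : ℝ} (hp : 0 < p) (hy : y ∈ Icc (0 : ℝ) 1) : oddPow p y = y ^ p := by
  rw [oddPow, min_eq_left hy.2, max_eq_right hy.1, max_eq_left, Real.zero_rpow hp.ne', sub_zero]
  exact (min_le_left _ _).trans (by linarith [hy.1])

lemma oddPow_neg (p y : ℝ) : oddPow p (-y) = -oddPow p y := by
  simp [oddPow]

lemma abs_oddPow_le_one {p : ℝ} (hp : 0 ≤ p) (y : ℝ) : |oddPow p y| ≤ 1 := by
  have h : ∀ z : ℝ, max 0 (min z 1) ^ p ∈ Icc (0 : ℝ) 1 := fun z =>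
    ⟨Real.rpow_nonneg (le_max_left _ _) _,
      Real.rpow_le_one (le_max_left _ _) (max_le zero_le_one (min_le_right _ _)) hp⟩
  rw [oddPow, abs_le]
  constructor <;> linarith [(h y).1, (h y).2, (h (-y)).1, (h (-y)).2]

lemma abs_oddPow_sub_le {p : ℝ} (hp : 0 ≤ p) (hp1 : p ≤ 1) (y z : ℝ) :
    |oddPow p y - oddPow p z| ≤ 2 * |y - z| ^ p := by
  have h : ∀ y z : ℝ, |max 0 (min y 1) ^ p - max 0 (min z 1) ^ p| ≤ |y - z| ^ p := fun y z => by
    refine (abs_rpow_sub_rpow_le (le_max_left _ _) (le_max_left _ _) hp hp1).trans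
      (Real.rpow_le_rpow (abs_nonneg _) ?_ hp)
    refine (abs_max_sub_max_le_max _ _ _ _).trans (max_le (by simp) ?_)
    exact (abs_min_sub_min_le_max _ _ _ _).trans (max_le le_rfl (by simp))
  rw [oddPow, oddPow, sub_sub_sub_comm]
  refine (abs_sub _ _).trans ?_
  have h2 := h (-y) (-z)
  rw [show -y - -z = -(y - z) by ring, abs_neg] at h2
  linarith [h y z]

lemma oddPow_sub_mem_holderClass {d : ℕ} {β : ℝ} (hβ : 0 < β) (hβ1 : β ≤ 1) (a : ℝ) (i : Fin d) :
    (fun x : E d => oddPow β (x i - a)) ∈ holderClass d β 2 := by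
  rw [holderClass, holderFloor_eq_zero hβ1]
  refine ⟨contDiff_zero.2 ?_, fun x x' => ?_⟩
  · unfold oddPow
    have h : Continuous fun z : ℝ => max 0 (min z 1) ^ β :=
      (by fun_prop : Continuous fun z : ℝ => max 0 (min z 1)).rpow_const fun _ => Or.inr hβ.le
    exact (h.comp (by fun_prop : Continuous fun x : E d => x i - a)).sub
      (h.comp (by fun_prop : Continuous fun x : E d => -(x i - a)))
  · rw [taylorPoly_zero]
    refine (abs_oddPow_sub_le hβ.le hβ1 _ _).trans ?_
    rw [sub_sub_sub_cancel_right, norm_sub_rev]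
    exact mul_le_mul_of_nonneg_left
      (Real.rpow_le_rpow (abs_nonneg _) (abs_coord_le_norm (x' - x) i) hβ.le) zero_le_two

/-- An odd profile that grows from zero as slowly as the Hölder class permits. -/
lemma exists_odd_profile {β : ℝ} (hβ : 0 < β) :
    ∃ f : ℝ → ℝ, (∀ (d : ℕ) (i : Fin d) (a : ℝ), (fun x : E d => f (x i - a)) ∈ holderClass d β 2) ∧
      (∀ y, |f y| ≤ 1) ∧ (∀ y, f (-y) = -f y) ∧
      ∀ y ∈ Icc (0 : ℝ) 1, y ^ min 1 β ≤ 2 * f y := by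
  rcases le_or_gt β 1 with h | h
  · refine ⟨oddPow β, fun d i a => oddPow_sub_mem_holderClass hβ h a i, abs_oddPow_le_one hβ.le,
      oddPow_neg β, fun y hy => ?_⟩
    rw [oddPow_of_mem hβ hy, min_eq_right h]
    linarith [Real.rpow_nonneg hy.1 β]
  · refine ⟨Real.sin, fun d i a => sin_sub_mem_holderClass hβ a i, Real.abs_sin_le_one,
      Real.sin_neg, fun y hy => ?_⟩
    rw [min_eq_left h.le, Real.rpow_one]
    -- Jordan's inequality `sin y ≥ (2/π) y`, with `π ≤ 4`.
    have h1 := Real.mul_le_sin hy.1 (by linarith [hy.2, Real.pi_gt_three])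
    have h2 : 1 / 2 ≤ 2 / Real.pi := by
      rw [div_le_div_iff₀ two_pos Real.pi_pos]
      linarith [Real.pi_le_four]
    nlinarith [mul_le_mul_of_nonneg_right h2 hy.1]

/-! ### Volumes of balls and slabs for the margin condition -/

lemma exists_closedBall_subset_of_interior_nonempty {d : ℕ} {C : Set (E d)}
    (hC : (interior C).Nonempty) : ∃ x₀ : E d, ∃ ρ > 0, ρ ≤ 1 ∧ Metric.closedBall x₀ ρ ⊆ C := by
  obtain ⟨x₀, hx₀⟩ := hC
  obtain ⟨ρ, hρ, hsub⟩ :=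
    Metric.nhds_basis_closedBall.mem_iff.1 (mem_interior_iff_mem_nhds.1 hx₀)
  exact ⟨x₀, min ρ 1, lt_min hρ one_pos, min_le_right _ _,
    (Metric.closedBall_subset_closedBall (min_le_left _ _)).trans hsub⟩

lemma volume_le_of_subset_closedBall {d : ℕ} {α K p t : ℝ} (hK : 0 < K) (ht : 0 < t)
    (ht1 : t ≤ 1) (hp : α ≤ p * d) {x₀ : E d} {S : Set (E d)}
    (hS : S ⊆ Metric.closedBall x₀ (K * t ^ p)) :
    volume S ≤
      ENNReal.ofReal (K ^ d * (volume (Metric.closedBall (0 : E d) 1)).toReal * t ^ α) := by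
  refine (measure_mono hS).trans ?_
  rw [volume_closedBall_eq _ (by positivity)]
  refine ENNReal.ofReal_le_ofReal ?_
  rw [mul_pow, ← Real.rpow_natCast (t ^ p), ← Real.rpow_mul ht.le, mul_right_comm]
  exact mul_le_mul_of_nonneg_left (Real.rpow_le_rpow_of_exponent_ge ht ht1 hp) (by positivity)

/-- The enclosing box has half-width `s` along `i` and 1 along the other axes. -/
lemma volume_slab_le {d : ℕ} (x₀ : E d) (i : Fin d) {s : ℝ} (hs : 0 ≤ s) {S : Set (E d)}
    (hS : S ⊆ Metric.closedBall x₀ 1) (hSi : ∀ x ∈ S, |x i - x₀ i| ≤ s) :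
    volume S ≤ ENNReal.ofReal (2 ^ d * s) := by
  set B : Set (Fin d → ℝ) := Icc (fun j => x₀ j - if j = i then s else 1)
    (fun j => x₀ j + if j = i then s else 1)
  have hsub : S ⊆ (@WithLp.ofLp 2 (Fin d → ℝ)) ⁻¹' B := by
    intro x hx
    have h1 : ∀ j, |x j - x₀ j| ≤ if j = i then s else 1 := by
      intro j
      split_ifs with h
      · rw [h]; exact hSi x hx
      · refine (abs_coord_le_norm (x - x₀) j).trans ?_
        simpa [dist_eq_norm] using hS hx
    refine ⟨fun j => ?_, fun j => ?_⟩ <;> have := abs_le.1 (h1 j) <;> dsimp only <;>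
      linarith [this.1, this.2]
  refine (measure_mono hsub).trans ?_
  rw [(PiLp.volume_preserving_ofLp (Fin d)).measure_preimage measurableSet_Icc.nullMeasurableSet,
    Real.volume_Icc_pi, ← ENNReal.ofReal_prod_of_nonneg]
  · refine ENNReal.ofReal_le_ofReal (le_of_eq ?_)
    have : ∀ j, x₀ j + (if j = i then s else 1) - (x₀ j - if j = i then s else 1) =
        2 * if j = i then s else 1 := fun j => by ring
    rw [Finset.prod_congr rfl fun j _ => this j, Finset.prod_mul_distrib]
    simp
  · intro j _
    have : 0 ≤ if j = i then s else 1 := by split_ifs <;> linarith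
    linarith

lemma rpow_le_imp_le_rpow {y b γ : ℝ} (hy : 0 ≤ y) (hγ : 0 < γ) (h : y ^ γ ≤ b) :
    y ≤ b ^ (1 / γ) := by
  have := Real.rpow_le_rpow (Real.rpow_nonneg hy γ) h (by positivity : 0 ≤ 1 / γ)
  rwa [← Real.rpow_mul hy, mul_one_div_cancel hγ.ne', Real.rpow_one] at this

/-! ### Extremal regression functions -/

/-- An admissible regression function depending on one coordinate, crossing `1 / 2` at `a` as
steeply as the Hölder class permits. -/
lemma exists_steep_regression {d : ℕ} (i : Fin d) (a : ℝ) {β L : ℝ} (hβ : 0 < β) (hL : 0 < L) :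
    ∃ g ∈ holderClass d β L, (∀ x, g x ∈ Icc (0 : ℝ) 1) ∧ (∀ x : E d, x i = a → g x = 1 / 2) ∧
      (∀ x : E d, a < x i → x i ≤ a + 1 → 1 / 2 < g x) ∧
      (∀ x : E d, a - 1 ≤ x i → x i < a → g x < 1 / 2) ∧
      ∃ K > 0, ∀ x : E d, |x i - a| ≤ 1 → ∀ t > 0, |g x - 1 / 2| ≤ t →
        |x i - a| ≤ K * t ^ (1 / min 1 β) := by
  obtain ⟨f, hf, hf1, hodd, hpos⟩ := exists_odd_profile hβ
  have hγ : 0 < min 1 β := lt_min one_pos hβ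
  -- The bound `1/2` keeps the values in `[0, 1]`; `L / 2` offsets the Hölder constant 2 of the
  -- profile.
  set c := min (1 / 2) (L / 2) with hc
  have hcpos : 0 < c := lt_min (by norm_num) (by positivity)
  have hc1 : c ≤ 1 / 2 := min_le_left _ _
  have hc2 : c ≤ L / 2 := min_le_right _ _
  have hf0 : ∀ y, 0 < y → y ≤ 1 → 0 < f y := fun y h0 h1 => by
    have := hpos y ⟨h0.le, h1⟩
    have := Real.rpow_pos_of_pos h0 (min 1 β)
    linarith
  refine ⟨fun x => 1 / 2 + c * f (x i - a), ?_, fun x => ?_, fun x hx => ?_, fun x h1 h2 => ?_,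
    fun x h1 h2 => ?_, (2 / c) ^ (1 / min 1 β), by positivity, fun x hx t ht h => ?_⟩
  · refine mem_holderClass_mono ?_
      (add_mem_holderClass (const_mem_holderClass β _) (const_mul_mem_holderClass (hf d i a) c))
    rw [abs_of_pos hcpos]
    linarith
  · have := abs_le.1 (hf1 (x i - a))
    constructor <;> nlinarith
  · have h0 : f 0 = 0 := by have := hodd 0; rw [neg_zero] at this; linarith
    simp [hx, h0]
  · have := mul_pos hcpos (hf0 (x i - a) (by linarith) (by linarith))
    linarith
  · have h3 := mul_pos hcpos (hf0 (-(x i - a)) (by linarith) (by linarith))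
    rw [hodd] at h3
    linarith
  · have h3 : |x i - a| ^ min 1 β ≤ 2 * |f (x i - a)| := by
      have h4 := hpos (|x i - a|) ⟨abs_nonneg _, hx⟩
      have h5 : |f (|x i - a|)| = |f (x i - a)| := by
        rcases abs_choice (x i - a) with h | h <;> rw [h]
        rw [hodd, abs_neg]
      linarith [le_abs_self (f (|x i - a|))]
    have h4 : |x i - a| ^ min 1 β ≤ 2 / c * t := by
      rw [add_sub_cancel_left, abs_mul, abs_of_pos hcpos] at h
      refine h3.trans ?_
      rw [div_mul_eq_mul_div, le_div_iff₀ hcpos]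
      linarith
    rw [← Real.mul_rpow (by positivity) ht.le]
    exact rpow_le_imp_le_rpow (abs_nonneg _) hγ h4

/-- An admissible regression function with a quadratic minimum of value `1 / 2` at `x₀`. -/
lemma exists_quadratic_regression {d : ℕ} (hd : 1 ≤ d) (x₀ : E d) {β L : ℝ} (hβ : 0 < β)
    (hL : 0 < L) :
    ∃ g ∈ holderClass d β L, (∀ x, g x ∈ Icc (0 : ℝ) 1) ∧ g x₀ = 1 / 2 ∧
      ∃ k > 0, ∀ x ∈ Metric.closedBall x₀ 1, k * ‖x - x₀‖ ^ 2 ≤ g x - 1 / 2 := by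
  have hd0 : (0 : ℝ) < d := by exact_mod_cast hd
  -- The function is `1/2 + c ∑ (1 - cos)`. The sum is at most `2 d`, so `c d ≤ 1/4` keeps the
  -- values in `[0, 1]`; its Hölder constant is `2 c d ≤ L`.
  set c := min (1 / (4 * d : ℝ)) (L / (2 * d)) with hc
  have hcpos : 0 < c := lt_min (by positivity) (by positivity)
  have hc1 : c * d ≤ 1 / 4 := by
    calc c * d ≤ 1 / (4 * d : ℝ) * d := mul_le_mul_of_nonneg_right (min_le_left _ _) hd0.le
      _ = 1 / 4 := by field_simp
  have hc2 : c * d ≤ L / 2 := by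
    calc c * d ≤ L / (2 * d : ℝ) * d := mul_le_mul_of_nonneg_right (min_le_right _ _) hd0.le
      _ = L / 2 := by field_simp
  have heq : ∀ x : E d, 1 / 2 + c * d + -c * ∑ i, Real.cos (x i - x₀ i) =
      1 / 2 + c * ∑ i, (1 - Real.cos (x i - x₀ i)) := fun x => by
    rw [Finset.sum_sub_distrib]
    simp
    ring
  refine ⟨fun x => 1 / 2 + c * d + -c * ∑ i, Real.cos (x i - x₀ i), ?_, fun x => ?_, ?_,
    c / 8, by positivity, fun x hx => ?_⟩
  · refine mem_holderClass_mono ?_ (add_mem_holderClass (const_mem_holderClass β _)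
      (const_mul_mem_holderClass
        (sum_mem_holderClass Finset.univ fun i => cos_sub_mem_holderClass hβ (x₀ i) i) (-c)))
    rw [abs_neg, abs_of_pos hcpos, Finset.card_univ, Fintype.card_fin]
    linarith
  · have h1 : 0 ≤ ∑ i, (1 - Real.cos (x i - x₀ i)) :=
      Finset.sum_nonneg fun i _ => by linarith [Real.cos_le_one (x i - x₀ i)]
    have h2 : ∑ i, (1 - Real.cos (x i - x₀ i)) ≤ d * 2 := by
      refine (Finset.sum_le_card_nsmul _ _ 2 fun i _ => ?_).trans_eq (by simp)
      linarith [Real.neg_one_le_cos (x i - x₀ i)]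
    change 1 / 2 + c * d + -c * ∑ i, Real.cos (x i - x₀ i) ∈ _
    rw [heq]
    have h3 := mul_nonneg hcpos.le h1
    have h4 := mul_le_mul_of_nonneg_left h2 hcpos.le
    constructor <;> linarith
  · change 1 / 2 + c * d + -c * ∑ i, Real.cos (x₀ i - x₀ i) = _
    rw [heq]
    simp
  · change _ ≤ 1 / 2 + c * d + -c * ∑ i, Real.cos (x i - x₀ i) - 1 / 2
    rw [heq, add_sub_cancel_left, EuclideanSpace.real_norm_sq_eq, div_mul_eq_mul_div, mul_div_assoc]
    refine mul_le_mul_of_nonneg_left ?_ hcpos.le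
    rw [Finset.sum_div]
    refine Finset.sum_le_sum fun i _ => ?_
    have h1 : |x i - x₀ i| ≤ 1 :=
      (abs_coord_le_norm (x - x₀) i).trans (by simpa [dist_eq_norm] using hx)
    -- `1 - cos y ≥ 2 y² / π² ≥ y² / 8`, the source of `k = c / 8`.
    have h2 := Real.cos_le_one_sub_mul_cos_sq (h1.trans (by linarith [Real.pi_gt_three]))
    have h3 : 1 / 8 ≤ 2 / Real.pi ^ 2 := by
      rw [div_le_div_iff₀ (by norm_num) (by positivity)]
      nlinarith [Real.pi_le_four, Real.pi_pos]
    have h4 := mul_le_mul_of_nonneg_right h3 (sq_nonneg (x i - x₀ i))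
    simp only [PiLp.sub_apply]
    linarith

/-! ### A cone with the hitting point as vertex -/

lemma norm_add_single_sub {d : ℕ} (x₀ : E d) (i : Fin d) (s : ℝ) :
    ‖x₀ + EuclideanSpace.single i s - x₀‖ = |s| := by
  rw [add_sub_cancel_left, PiLp.norm_single, Real.norm_eq_abs]

lemma add_single_mem_closedBall {d : ℕ} (x₀ : E d) (i : Fin d) {s r : ℝ} (h : |s| ≤ r) :
    x₀ + EuclideanSpace.single i s ∈ Metric.closedBall x₀ r := by
  rwa [Metric.mem_closedBall, dist_eq_norm, norm_add_single_sub]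

/-- The truncated cone with vertex `x₀` around the `i`-th coordinate direction. -/
def truncatedCone {d : ℕ} (x₀ : E d) (i : Fin d) (ρ : ℝ) : Set (E d) :=
  Metric.closedBall x₀ ρ ∩ {x | ‖x - x₀‖ ≤ 2 * (x i - x₀ i)}

section truncatedCone

variable {d : ℕ} (x₀ : E d) (i : Fin d) {ρ : ℝ}

lemma isCompact_truncatedCone : IsCompact (truncatedCone x₀ i ρ) :=
  (isCompact_closedBall x₀ ρ).inter_right (isClosed_le (by fun_prop) (by fun_prop))

lemma convex_truncatedCone : Convex ℝ (truncatedCone x₀ i ρ) := by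
  refine (convex_closedBall x₀ ρ).inter ?_
  intro x hx y hy a b ha hb hab
  simp only [mem_ofPred_eq] at hx hy ⊢
  have h1 : a • x + b • y - x₀ = a • (x - x₀) + b • (y - x₀) := by
    have : x₀ = a • x₀ + b • x₀ := by rw [← add_smul, hab, one_smul]
    nth_rw 1 [this]
    module
  have h2 : ‖a • (x - x₀) + b • (y - x₀)‖ ≤ a * ‖x - x₀‖ + b * ‖y - x₀‖ := by
    refine (norm_add_le _ _).trans_eq ?_
    rw [norm_smul, norm_smul, Real.norm_of_nonneg ha, Real.norm_of_nonneg hb]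
  rw [h1]
  have h3 : (a • x + b • y) i - x₀ i = a * (x i - x₀ i) + b * (y i - x₀ i) := by
    have : x₀ i = a * x₀ i + b * x₀ i := by rw [← add_mul, hab, one_mul]
    simp only [PiLp.add_apply, PiLp.smul_apply, smul_eq_mul]
    linarith
  rw [h3]
  nlinarith

lemma vertex_mem_truncatedCone (hρ : 0 < ρ) : x₀ ∈ truncatedCone x₀ i ρ :=
  ⟨Metric.mem_closedBall_self hρ.le, by simp⟩

lemma add_single_mem_truncatedCone {s : ℝ} (hs : 0 ≤ s) (hsρ : s ≤ ρ) :
    x₀ + EuclideanSpace.single i s ∈ truncatedCone x₀ i ρ := by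
  refine ⟨add_single_mem_closedBall x₀ i (by rwa [abs_of_nonneg hs]), ?_⟩
  rw [mem_ofPred_eq, norm_add_single_sub, abs_of_nonneg hs]
  simp
  linarith

lemma interior_truncatedCone_nonempty (hρ : 0 < ρ) : (interior (truncatedCone x₀ i ρ)).Nonempty := by
  refine ⟨x₀ + EuclideanSpace.single i (ρ / 2), mem_interior.2
    ⟨Metric.ball x₀ ρ ∩ {x | ‖x - x₀‖ < 2 * (x i - x₀ i)}, ?_, ?_, ?_, ?_⟩⟩
  · exact inter_subset_inter Metric.ball_subset_closedBall (ofPred_subset_ofPred.2 fun x hx => le_of_lt hx)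
  · exact Metric.isOpen_ball.inter (isOpen_lt (by fun_prop) (by fun_prop))
  · rw [Metric.mem_ball, dist_eq_norm, norm_add_single_sub, abs_of_pos (by positivity)]
    linarith
  · rw [mem_ofPred_eq, norm_add_single_sub, abs_of_pos (by positivity)]
    simp
    linarith

lemma vertex_mem_frontier_truncatedCone (hρ : 0 < ρ) : x₀ ∈ frontier (truncatedCone x₀ i ρ) := by
  rw [(isCompact_truncatedCone x₀ i).isClosed.frontier_eq]
  refine ⟨vertex_mem_truncatedCone x₀ i hρ, fun h => ?_⟩
  obtain ⟨r, hr, hsub⟩ := Metric.nhds_basis_closedBall.mem_iff.1 (mem_interior_iff_mem_nhds.1 h)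
  have h1 := (hsub (add_single_mem_closedBall x₀ i (s := -r) (by simp [abs_of_pos hr]))).2
  rw [mem_ofPred_eq, norm_add_single_sub, abs_neg, abs_of_pos hr] at h1
  simp at h1
  linarith

end truncatedCone

/-! ### The three examples -/

/-- In the cone the distance to the vertex is at most twice the `i`-th coordinate difference, so
closeness of `g` to `1/2` confines `x` to a ball of radius `2 K t ^ (1/γ)`. -/
theorem exists_law_hitsAt_frontier {d : ℕ} (hd : 1 ≤ d) {α β L : ℝ} (hα : 0 ≤ α) (hβ : 0 < β)
    (hL : 0 < L) {C : Set (E d)} (hαβ : α * min 1 β ≤ d) (hC : (interior C).Nonempty) :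
    ∃ c₀ r₀ C₀ μmin μmax : ℝ, 0 < c₀ ∧ 0 < r₀ ∧ 0 < C₀ ∧ 0 < μmin ∧ μmin < μmax ∧
      ∃ P ∈ lawClass α c₀ r₀ C₀ β L μmin μmax C, ∃ x₀ ∈ frontier (marginal P).support,
        ∀ η : E d → ℝ, IsRegressionFunction P η → Continuous η → HitsAt η (1 / 2) x₀ := by
  obtain ⟨x₀, ρ, hρ, hρ1, hsub⟩ := exists_closedBall_subset_of_interior_nonempty hC
  set i : Fin d := ⟨0, hd⟩
  have hγ : 0 < min 1 β := lt_min one_pos hβ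
  obtain ⟨g, hg, h01, hg0, hgp, -, K, hK, hgK⟩ := exists_steep_regression i (x₀ i) hβ hL
  have hv := volume_closedBall_toReal_pos (0 : E d) one_pos
  obtain ⟨c₀, r₀, C₀, μmin, μmax, h1, h2, h3, h4, h5, P, hP, hsupp, hη⟩ :=
    exists_mem_lawClass_of_convex hα
      (C₁ := (2 * K) ^ d * (volume (Metric.closedBall (0 : E d) 1)).toReal) (by positivity)
      (isCompact_truncatedCone x₀ i (ρ := ρ)) (inter_subset_left.trans hsub)
      (convex_truncatedCone x₀ i) (interior_truncatedCone_nonempty x₀ i hρ) hg h01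
      (fun t ht ht1 => by
        refine volume_le_of_subset_closedBall (p := 1 / min 1 β) (x₀ := x₀) (by positivity) ht ht1
          ?_ ?_
        · rw [one_div_mul_eq_div, le_div_iff₀ hγ]
          exact hαβ
        · rintro x ⟨⟨hx1, hx2⟩, -, hx3⟩
          have hx4 : ‖x - x₀‖ ≤ ρ := by simpa [dist_eq_norm] using hx1
          have h6 := hgK x ((abs_coord_le_norm (x - x₀) i).trans (hx4.trans hρ1)) t ht hx3
          have h7 : ‖x - x₀‖ ≤ 2 * (x i - x₀ i) := hx2
          rw [Metric.mem_closedBall, dist_eq_norm]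
          linarith [le_abs_self (x i - x₀ i)])
  refine ⟨c₀, r₀, C₀, μmin, μmax, h1, h2, h3, h4, h5, P, hP, x₀, ?_, fun η hr hc => ⟨?_, ?_⟩⟩
  · rw [hsupp]
    exact vertex_mem_frontier_truncatedCone x₀ i hρ
  · rw [hη η hr hc (vertex_mem_truncatedCone x₀ i hρ)]
    exact hg0 x₀ rfl
  · intro r hr0
    have hs : 0 < min r ρ := lt_min hr0 hρ
    refine ⟨x₀ + EuclideanSpace.single i (min r ρ),
      add_single_mem_closedBall x₀ i (by rw [abs_of_pos hs]; exact min_le_left _ _), ?_⟩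
    rw [hη η hr hc (add_single_mem_truncatedCone x₀ i hs.le (min_le_right _ _))]
    refine (hgp _ ?_ ?_).ne'
    · simpa using ⟨hr0, hρ⟩
    · simpa using Or.inr hρ1

theorem exists_law_hitsAt_interior {d : ℕ} (hd : 1 ≤ d) {α β L : ℝ} (hα : 0 ≤ α) (hβ : 0 < β)
    (hL : 0 < L) {C : Set (E d)} (hαd : 2 * α ≤ d) (hC : (interior C).Nonempty) :
    ∃ c₀ r₀ C₀ μmin μmax : ℝ, 0 < c₀ ∧ 0 < r₀ ∧ 0 < C₀ ∧ 0 < μmin ∧ μmin < μmax ∧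
      ∃ P ∈ lawClass α c₀ r₀ C₀ β L μmin μmax C, ∃ x₀ ∈ interior (marginal P).support,
        ∀ η : E d → ℝ, IsRegressionFunction P η → Continuous η → HitsAt η (1 / 2) x₀ := by
  obtain ⟨x₀, ρ, hρ, hρ1, hsub⟩ := exists_closedBall_subset_of_interior_nonempty hC
  set i : Fin d := ⟨0, hd⟩
  have hmono : Metric.closedBall x₀ ρ ⊆ Metric.closedBall x₀ 1 :=
    Metric.closedBall_subset_closedBall hρ1
  obtain ⟨g, hg, h01, hg0, k, hk, hgk⟩ := exists_quadratic_regression hd x₀ hβ hL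
  have hv := volume_closedBall_toReal_pos (0 : E d) one_pos
  have hint : x₀ ∈ interior (Metric.closedBall x₀ ρ) :=
    Metric.ball_subset_interior_closedBall (Metric.mem_ball_self hρ)
  obtain ⟨c₀, r₀, C₀, μmin, μmax, h1, h2, h3, h4, h5, P, hP, hsupp, hη⟩ :=
    exists_mem_lawClass_of_convex hα
      (C₁ := ((1 / k) ^ (1 / 2 : ℝ)) ^ d * (volume (Metric.closedBall (0 : E d) 1)).toReal)
      (by positivity) (isCompact_closedBall x₀ ρ) hsub (convex_closedBall x₀ ρ) ⟨x₀, hint⟩ hg h01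
      (fun t ht ht1 => by
        -- The minimum gives `k ‖x - x₀‖² ≤ t`, hence radius of order `t ^ (1/2)`; `2α ≤ d` is then
        -- the required exponent bound.
        refine volume_le_of_subset_closedBall (p := 1 / 2) (x₀ := x₀) (by positivity) ht ht1
          (by linarith) ?_
        rintro x ⟨hx1, -, hx3⟩
        have h6 := hgk x (hmono hx1)
        rw [Metric.mem_closedBall, dist_eq_norm, ← Real.mul_rpow (by positivity) ht.le]
        refine rpow_le_imp_le_rpow (norm_nonneg _) two_pos ?_
        rw [Real.rpow_two, div_mul_eq_mul_div, one_mul, le_div_iff₀ hk]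
        linarith [le_abs_self (g x - 1 / 2)])
  refine ⟨c₀, r₀, C₀, μmin, μmax, h1, h2, h3, h4, h5, P, hP, x₀, ?_, fun η hr hc => ⟨?_, ?_⟩⟩
  · rwa [hsupp]
  · rw [hη η hr hc (Metric.mem_closedBall_self hρ.le), hg0]
  · intro r hr0
    have hs : 0 < min r ρ := lt_min hr0 hρ
    have hmem := add_single_mem_closedBall x₀ i (abs_of_pos hs).le
    have hmem' := Metric.closedBall_subset_closedBall (min_le_right r ρ) hmem
    refine ⟨_, Metric.closedBall_subset_closedBall (min_le_left r ρ) hmem, ?_⟩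
    rw [hη η hr hc hmem']
    have h6 := hgk _ (hmono hmem')
    rw [norm_add_single_sub, sq_abs] at h6
    have : 0 < k * min r ρ ^ 2 := by positivity
    exact (by linarith : (1 : ℝ) / 2 < _).ne'

theorem exists_law_crossesAt_interior {d : ℕ} (hd : 1 ≤ d) {α β L : ℝ} (hα : 0 ≤ α) (hβ : 0 < β)
    (hL : 0 < L) {C : Set (E d)} (hαβ : α * min 1 β ≤ 1) (hC : (interior C).Nonempty) :
    ∃ c₀ r₀ C₀ μmin μmax : ℝ, 0 < c₀ ∧ 0 < r₀ ∧ 0 < C₀ ∧ 0 < μmin ∧ μmin < μmax ∧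
      ∃ P ∈ lawClass α c₀ r₀ C₀ β L μmin μmax C, ∃ x₀ ∈ interior (marginal P).support,
        ∀ η : E d → ℝ, IsRegressionFunction P η → Continuous η → CrossesAt η (1 / 2) x₀ := by
  obtain ⟨x₀, ρ, hρ, hρ1, hsub⟩ := exists_closedBall_subset_of_interior_nonempty hC
  set i : Fin d := ⟨0, hd⟩
  have hγ : 0 < min 1 β := lt_min one_pos hβ
  have hmono : Metric.closedBall x₀ ρ ⊆ Metric.closedBall x₀ 1 :=
    Metric.closedBall_subset_closedBall hρ1
  obtain ⟨g, hg, h01, -, hgp, hgn, K, hK, hgK⟩ := exists_steep_regression i (x₀ i) hβ hL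
  have hint : x₀ ∈ interior (Metric.closedBall x₀ ρ) :=
    Metric.ball_subset_interior_closedBall (Metric.mem_ball_self hρ)
  obtain ⟨c₀, r₀, C₀, μmin, μmax, h1, h2, h3, h4, h5, P, hP, hsupp, hη⟩ :=
    exists_mem_lawClass_of_convex hα (C₁ := 2 ^ d * K) (by positivity)
      (isCompact_closedBall x₀ ρ) hsub (convex_closedBall x₀ ρ) ⟨x₀, hint⟩ hg h01
      (fun t ht ht1 => by
        refine (volume_slab_le x₀ i (s := K * t ^ (1 / min 1 β)) (by positivity)
          (inter_subset_left.trans hmono) ?_).trans (ENNReal.ofReal_le_ofReal ?_)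
        · rintro x ⟨hx1, -, hx3⟩
          have hx4 : ‖x - x₀‖ ≤ 1 := by simpa [dist_eq_norm] using hmono hx1
          exact hgK x ((abs_coord_le_norm (x - x₀) i).trans hx4) t ht hx3
        · rw [← mul_assoc]
          refine mul_le_mul_of_nonneg_left
            (Real.rpow_le_rpow_of_exponent_ge ht ht1 ?_) (by positivity)
          rwa [le_div_iff₀ hγ])
  refine ⟨c₀, r₀, C₀, μmin, μmax, h1, h2, h3, h4, h5, P, hP, x₀, by rwa [hsupp], ?_⟩
  intro η hr hc r hr0
  have hs : 0 < min r ρ := lt_min hr0 hρ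
  have hsρ : min r ρ ≤ 1 := (min_le_right _ _).trans hρ1
  have hm := add_single_mem_closedBall x₀ i (s := -min r ρ) (by rw [abs_neg, abs_of_pos hs])
  have hp := add_single_mem_closedBall x₀ i (abs_of_pos hs).le
  refine ⟨_, Metric.closedBall_subset_closedBall (min_le_left r ρ) hm,
    _, Metric.closedBall_subset_closedBall (min_le_left r ρ) hp, ?_, ?_⟩
  · rw [hη η hr hc (Metric.closedBall_subset_closedBall (min_le_right r ρ) hm)]
    refine hgn _ ?_ ?_ <;> simp only [PiLp.add_apply, PiLp.single_apply, if_true] <;>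
      linarith
  · rw [hη η hr hc (Metric.closedBall_subset_closedBall (min_le_right r ρ) hp)]
    refine hgp _ ?_ ?_ <;> simp only [PiLp.add_apply, PiLp.single_apply, if_true] <;>
      linarith

end FastPlugin

theorem mainTheorem8
    (d : ℕ) (hd : 1 ≤ d) (α β L : ℝ) (hα : 0 ≤ α) (hβ : 0 < β) (hL : 0 < L)
    (C : Set (EuclideanSpace ℝ (Fin d))) (hC : IsCompact C) :
    -- no hitting in the interior
    ((d : ℝ) < α * min 1 β →
      ∀ c₀ r₀ C₀ μmin μmax : ℝ, 0 < c₀ → 0 < r₀ → 0 < C₀ → 0 < μmin → μmin < μmax →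
        ∀ P ∈ lawClass α c₀ r₀ C₀ β L μmin μmax C,
          ∀ η : EuclideanSpace ℝ (Fin d) → ℝ, IsRegressionFunction P η → Continuous η →
            ∀ x₀ ∈ interior (marginal P).support, ¬ HitsAt η (1 / 2) x₀) ∧
    -- hitting on the boundary
    (α * min 1 β ≤ (d : ℝ) → (interior C).Nonempty →
      ∃ c₀ r₀ C₀ μmin μmax : ℝ, 0 < c₀ ∧ 0 < r₀ ∧ 0 < C₀ ∧ 0 < μmin ∧ μmin < μmax ∧
        ∃ P ∈ lawClass α c₀ r₀ C₀ β L μmin μmax C,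
          ∃ x₀ ∈ frontier (marginal P).support,
            ∀ η : EuclideanSpace ℝ (Fin d) → ℝ, IsRegressionFunction P η → Continuous η →
              HitsAt η (1 / 2) x₀) ∧
    -- hitting in the interior
    (2 * α ≤ (d : ℝ) → (interior C).Nonempty →
      ∃ c₀ r₀ C₀ μmin μmax : ℝ, 0 < c₀ ∧ 0 < r₀ ∧ 0 < C₀ ∧ 0 < μmin ∧ μmin < μmax ∧
        ∃ P ∈ lawClass α c₀ r₀ C₀ β L μmin μmax C,
          ∃ x₀ ∈ interior (marginal P).support,
            ∀ η : EuclideanSpace ℝ (Fin d) → ℝ, IsRegressionFunction P η → Continuous η →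
              HitsAt η (1 / 2) x₀) ∧
    -- no crossing in the interior
    (1 < α * min 1 β →
      ∀ c₀ r₀ C₀ μmin μmax : ℝ, 0 < c₀ → 0 < r₀ → 0 < C₀ → 0 < μmin → μmin < μmax →
        ∀ P ∈ lawClass α c₀ r₀ C₀ β L μmin μmax C,
          ∀ η : EuclideanSpace ℝ (Fin d) → ℝ, IsRegressionFunction P η → Continuous η →
            ∀ x₀ ∈ interior (marginal P).support, ¬ CrossesAt η (1 / 2) x₀) ∧
    -- crossing in the interior
    (α * min 1 β ≤ 1 → (interior C).Nonempty →
      ∃ c₀ r₀ C₀ μmin μmax : ℝ, 0 < c₀ ∧ 0 < r₀ ∧ 0 < C₀ ∧ 0 < μmin ∧ μmin < μmax ∧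
        ∃ P ∈ lawClass α c₀ r₀ C₀ β L μmin μmax C,
          ∃ x₀ ∈ interior (marginal P).support,
            ∀ η : EuclideanSpace ℝ (Fin d) → ℝ, IsRegressionFunction P η → Continuous η →
              CrossesAt η (1 / 2) x₀) := by
  have hγ : 0 < min 1 β := lt_min one_pos hβ
  refine ⟨?_, fun h hi => exists_law_hitsAt_frontier hd hα hβ hL h hi,
    fun h hi => exists_law_hitsAt_interior hd hα hβ hL h hi, ?_,
    fun h hi => exists_law_crossesAt_interior hd hα hβ hL h hi⟩
  · intro h c₀ r₀ C₀ μmin μmax _ _ hC₀ hμ _ P hP η hη hηc x₀ hx₀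
    obtain ⟨R, hR, K, hK, K', hK', hH, hM⟩ := exists_local_bounds hL hC₀ hμ hP hη hηc hx₀
    exact not_hitsAt_of_local_bounds hηc hγ hR hK hK' hH hM h
  · intro h c₀ r₀ C₀ μmin μmax _ _ hC₀ hμ _ P hP η hη hηc x₀ hx₀
    obtain ⟨R, hR, K, hK, K', hK', hH, hM⟩ := exists_local_bounds hL hC₀ hμ hP hη hηc hx₀
    exact not_crossesAt_of_local_bounds hηc hγ hR hK hK' hH hM h
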